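/- On $\mathbb R^3$ with points $z=(x,y,t)$ and Lebesgue measure $dz$, let $X=\partial_x+2y\,\partial_t$ and $Y=\partial_y-2x\,\partial_t$, and for a $C^2$ function $w$ put $$\mathcal H(w)=\begin{pmatrix} X^2w & \tfrac12(XYw+YXw)\\ \tfrac12(XYw+YXw) & Y^2w\end{pmatrix}.$$ A function $w\in C^2(\Omega)$ is called $\mathcal H$-convex in $\Omega$ if $\mathcal H(w)$ is positive semidefinite at every point of $\Omega$. **Theorem 3.1.** Let $\Omega\subset\mathbb R^3$ be a bounded open set and let $u,v\in C^2(\bar\Omega)$, that is, $u$ and $v$ are continuous on $\bar\Omega$, of class $C^2$ in $\Omega$, and their partial derivatives of order at most two extend continuously from $\Omega$ to $\bar\Omega$. Suppose that $u+v$ is $\mathcal H$-convex in $\Omega$, that $v=u$ on $\partial\Omega$, and that $v<u$ in $\Omega$. Then $$\int_\Omega\left\{\det\mathcal H(u)+12\,(\partial_t u)^2\right\}dz\;\le\;\int_\Omega\left\{\det\mathcal H(v)+12\,(\partial_t v)^2\right\}dz$$ and $$\int_\Omega \operatorname{trace}\mathcal H(u)\,dz\;\le\;\int_\Omega\operatorname{trace}\mathcal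 H(v)\,dz ,$$ where all four integrands are integrable over $\Omega$. -/

import Mathlib

open MeasureTheory

namespace Heisenberg

/-- The underlying space ℝ³ of the Heisenberg group, with coordinates `x = z 0`, `y = z 1`,
`t = z 2`; its `volume` is Lebesgue measure `dz`. -/
abbrev R3 : Type := EuclideanSpace ℝ (Fin 3)

/-- The partial derivative in the `i`-th coordinate direction. -/
noncomputable def pderiv (i : Fin 3) (u : R3 → ℝ) (z : R3) : ℝ :=
  fderiv ℝ u z (EuclideanSpace.single i (1 : ℝ))

/-- The vertical derivative `∂ₜ`. -/
noncomputable def T (u : R3 → ℝ) (z : R3) : ℝ := pderiv 2 u z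

/-- The vector field `X = ∂ₓ + 2 y ∂ₜ`. -/
noncomputable def X (u : R3 → ℝ) (z : R3) : ℝ := pderiv 0 u z + 2 * z 1 * T u z

/-- The vector field `Y = ∂_y - 2 x ∂ₜ`. -/
noncomputable def Y (u : R3 → ℝ) (z : R3) : ℝ := pderiv 1 u z - 2 * z 0 * T u z

/-- The symmetrized horizontal Hessian of `u` at `z`. -/
noncomputable def hess (u : R3 → ℝ) (z : R3) : Matrix (Fin 2) (Fin 2) ℝ :=
  !![X (X u) z, (X (Y u) z + Y (X u) z) / 2;
     (X (Y u) z + Y (X u) z) / 2, Y (Y u) z]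

/-- A function `u` of class `C²(Ω)` is `ℋ`-convex in `Ω` if its symmetrized horizontal Hessian
is positive semidefinite at every point of `Ω`. -/
def HConvexOn (Ω : Set R3) (u : R3 → ℝ) : Prop :=
  ContDiffOn ℝ 2 u Ω ∧ ∀ z ∈ Ω, (hess u z).PosSemidef

/-- The class `C²(Ω̄)` for open `Ω`: `u` is continuous on the closure, of class `C²` in `Ω`, and
its derivatives of order at most two extend continuously from `Ω` to the closure of `Ω`. -/
def C2Closure (Ω : Set R3) (u : R3 → ℝ) : Prop :=
  ContinuousOn u (closure Ω) ∧ ContDiffOn ℝ 2 u Ω ∧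
    ∀ k : ℕ, k ≤ 2 → ∃ g : R3 → ContinuousMultilinearMap ℝ (fun _ : Fin k => R3) ℝ,
      ContinuousOn g (closure Ω) ∧ Set.EqOn g (iteratedFDeriv ℝ k u) Ω

/-- The Monge–Ampère type density `det ℋ(u) + 12 (∂ₜ u)²`. -/
noncomputable def mongeAmpere (u : R3 → ℝ) (z : R3) : ℝ :=
  (hess u z).det + 12 * (T u z) ^ 2

end Heisenberg

/-! Put `w = u - v` and `s = u + v`. The Monge–Ampère density is a quadratic form in the derivatives
of a function, with polarization `polar`, so the difference of the densities of `u` and `v` is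
`polar w s`. It remains to show that its integral over `Ω` is nonpositive.

The constant 12 makes `polar` a null form. For `f` of class C² with compact support and `s` of class
C³, `polar f s` is half of `X F + Y G`, where `F` and `G` are linear in the horizontal gradient of
`f`. The third derivatives of `s` cancel because `[X, Y] = -4 ∂ₜ` and `∂ₜ` commutes with `X` and
`Y`. Hence the integral of `polar f s` vanishes, and mollification extends this to compactly
supported `s` of class C² (`integral_polar_eq_zero`).

Since `Ω` has no boundary regularity, `w` is replaced by `g ∘ w`, where `g` is convex and vanishes
near 0, so that its extension by zero is C² with compact support. By `polar_comp`, this replaces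
`polar w s` by `g'(w) * polar w s` plus `g''(w) / 2` times the cofactor form of the Hessian of `s`
on the horizontal gradient of `w`. The extra term is nonnegative by ℋ-convexity, so the integral of
`g'(w) * polar w s` is at most 0. Letting `g'` tend to 1 on the positive reals gives the claim,
because `w > 0` in `Ω`.

The trace inequality follows in the same way from `X² + Y²`, where the extra term is `g''(w)` times
the squared length of the horizontal gradient and no convexity is needed. -/

namespace Heisenberg

open Filter Topology

/-! ### Derivatives along vector fields -/

/-- The derivative of `f` along the vector field `V`. -/
noncomputable def along (V : R3 → R3) (f : R3 → ℝ) (z : R3) : ℝ := fderiv ℝ f z (V z)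

/-- The vector field `∂ₓ + 2 y ∂ₜ`. -/
noncomputable def vX (z : R3) : R3 :=
  EuclideanSpace.single 0 (1 : ℝ) + (2 * z 1) • EuclideanSpace.single 2 (1 : ℝ)

/-- The vector field `∂_y - 2 x ∂ₜ`. -/
noncomputable def vY (z : R3) : R3 :=
  EuclideanSpace.single 1 (1 : ℝ) - (2 * z 0) • EuclideanSpace.single 2 (1 : ℝ)

/-- The vector field `∂ₜ`. -/
noncomputable def vT (_ : R3) : R3 := EuclideanSpace.single 2 (1 : ℝ)

theorem X_eq_along : X = along vX := by
  funext u z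
  simp [X, T, pderiv, along, vX]

theorem Y_eq_along : Y = along vY := by
  funext u z
  simp [Y, T, pderiv, along, vY]

theorem T_eq_along : T = along vT := rfl

theorem contDiff_coord (i : Fin 3) {n : WithTop ℕ∞} : ContDiff ℝ n (fun z : R3 => z i) :=
  (EuclideanSpace.proj i : R3 →L[ℝ] ℝ).contDiff

theorem contDiff_vX {n : WithTop ℕ∞} : ContDiff ℝ n vX :=
  contDiff_const.add ((contDiff_const.mul (contDiff_coord 1)).smul contDiff_const)

theorem contDiff_vY {n : WithTop ℕ∞} : ContDiff ℝ n vY :=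
  contDiff_const.sub ((contDiff_const.mul (contDiff_coord 0)).smul contDiff_const)

theorem contDiff_vT {n : WithTop ℕ∞} : ContDiff ℝ n vT := contDiff_const

theorem hasFDerivAt_coord (i : Fin 3) (z : R3) :
    HasFDerivAt (fun z : R3 => z i)
      (EuclideanSpace.proj i : R3 →L[ℝ] ℝ) z :=
  (EuclideanSpace.proj i : R3 →L[ℝ] ℝ).hasFDerivAt

theorem fderiv_vX (z w : R3) :
    fderiv ℝ vX z w = (2 * w 1) • EuclideanSpace.single 2 (1 : ℝ) := by
  have h := (((hasFDerivAt_coord 1 z).const_mul 2).smul_const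
    (EuclideanSpace.single (2 : Fin 3) (1 : ℝ))).const_add
    (EuclideanSpace.single (0 : Fin 3) (1 : ℝ))
  have h2 : fderiv ℝ vX z = _ := h.fderiv
  rw [h2]
  simp

theorem fderiv_vY (z w : R3) :
    fderiv ℝ vY z w = -((2 * w 0) • EuclideanSpace.single 2 (1 : ℝ)) := by
  have h := (((hasFDerivAt_coord 0 z).const_mul 2).smul_const
    (EuclideanSpace.single (2 : Fin 3) (1 : ℝ))).const_sub
    (EuclideanSpace.single (1 : Fin 3) (1 : ℝ))
  have h2 : fderiv ℝ vY z = _ := h.fderiv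
  rw [h2]
  simp

theorem fderiv_vT (z w : R3) : fderiv ℝ vT z w = 0 := by
  have : fderiv ℝ vT z = 0 := (hasFDerivAt_const _ _).fderiv
  simp [this]

theorem contDiffAt_along {V : R3 → R3} {f : R3 → ℝ} {z : R3} {n m : WithTop ℕ∞}
    (hV : ContDiff ℝ n V) (hf : ContDiffAt ℝ m f z) (h : n + 1 ≤ m) :
    ContDiffAt ℝ n (along V f) z :=
  (hf.fderiv_right h).clm_apply hV.contDiffAt

theorem contDiff_along {V : R3 → R3} {f : R3 → ℝ} {n m : WithTop ℕ∞}
    (hV : ContDiff ℝ n V) (hf : ContDiff ℝ m f) (h : n + 1 ≤ m) :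
    ContDiff ℝ n (along V f) :=
  contDiff_iff_contDiffAt.2 fun _ => contDiffAt_along hV hf.contDiffAt h

theorem along_congr {V : R3 → R3} {f g : R3 → ℝ} {z : R3} (h : f =ᶠ[𝓝 z] g) :
    along V f =ᶠ[𝓝 z] along V g :=
  (h.fderiv (𝕜 := ℝ)).mono fun y hy => by simp [along, hy]

theorem along_along {V W : R3 → R3} {f : R3 → ℝ} {z : R3}
    (hW : ContDiff ℝ 1 W) (hf : ContDiffAt ℝ 2 f z) :
    along V (along W f) z =
      fderiv ℝ (fderiv ℝ f) z (V z) (W z) + fderiv ℝ f z (fderiv ℝ W z (V z)) := by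
  have h1 : HasFDerivAt (fderiv ℝ f) (fderiv ℝ (fderiv ℝ f) z) z :=
    ((hf.fderiv_right (m := 1) (by norm_num)).differentiableAt (by norm_num)).hasFDerivAt
  have h2 : HasFDerivAt W (fderiv ℝ W z) z :=
    (hW.contDiffAt.differentiableAt (by norm_num)).hasFDerivAt
  have h3 : fderiv ℝ (along W f) z = _ := (h1.clm_apply h2).fderiv
  rw [along, h3]
  simp [add_comm]

/-- Symmetry of the second derivative cancels the second order part of the commutator and leaves the
derivative along the Lie bracket of the fields. -/
theorem along_sub_along {V W : R3 → R3} {f : R3 → ℝ} {z : R3}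
    (hV : ContDiff ℝ 1 V) (hW : ContDiff ℝ 1 W) (hf : ContDiffAt ℝ 2 f z) :
    along V (along W f) z - along W (along V f) z =
      fderiv ℝ f z (fderiv ℝ W z (V z) - fderiv ℝ V z (W z)) := by
  have hs : IsSymmSndFDerivAt ℝ f z := hf.isSymmSndFDerivAt (by simp)
  rw [along_along hW hf, along_along hV hf, hs.eq (V z) (W z), map_sub]
  ring

theorem commute_X_Y {f : R3 → ℝ} {z : R3} (hf : ContDiffAt ℝ 2 f z) :
    along vX (along vY f) z = along vY (along vX f) z - 4 * along vT f z := by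
  have h := along_sub_along contDiff_vX contDiff_vY hf
  have e : fderiv ℝ vY z (vX z) - fderiv ℝ vX z (vY z) = (-4 : ℝ) • vT z := by
    rw [fderiv_vX, fderiv_vY]
    simp [vX, vY, vT]
    module
  rw [e, map_smul, smul_eq_mul] at h
  simp only [along] at h ⊢
  linarith

theorem commute_T_X {f : R3 → ℝ} {z : R3} (hf : ContDiffAt ℝ 2 f z) :
    along vT (along vX f) z = along vX (along vT f) z := by
  have h := along_sub_along contDiff_vT contDiff_vX hf
  have e : fderiv ℝ vX z (vT z) - fderiv ℝ vT z (vX z) = 0 := by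
    rw [fderiv_vX, fderiv_vT]
    simp [vT]
  rw [e, map_zero] at h
  linarith

theorem commute_T_Y {f : R3 → ℝ} {z : R3} (hf : ContDiffAt ℝ 2 f z) :
    along vT (along vY f) z = along vY (along vT f) z := by
  have h := along_sub_along contDiff_vT contDiff_vY hf
  have e : fderiv ℝ vY z (vT z) - fderiv ℝ vT z (vY z) = 0 := by
    rw [fderiv_vY, fderiv_vT]
    simp [vT]
  rw [e, map_zero] at h
  linarith

/-! ### Integration by parts -/

/-- The coefficient is constant in the direction of differentiation, so integration by parts leaves
no term. Applied to each component of `vX` and `vY`, this says that both fields are divergence free.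
-/
theorem integral_mul_fderiv_eq_zero {a F : R3 → ℝ} {e : R3} (ha : ContDiff ℝ 1 a)
    (hae : ∀ z, fderiv ℝ a z e = 0) (hF : ContDiff ℝ 1 F) (hc : HasCompactSupport F) :
    Integrable (fun z => a z * fderiv ℝ F z e) ∧ ∫ z, a z * fderiv ℝ F z e = 0 := by
  have hF' : Continuous fun z => fderiv ℝ F z e :=
    (hF.continuous_fderiv (by norm_num)).clm_apply continuous_const
  have hc' : HasCompactSupport fun z => fderiv ℝ F z e := hc.fderiv_apply (𝕜 := ℝ) e
  have hint : Integrable (fun z => a z * fderiv ℝ F z e) :=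
    (ha.continuous.mul hF').integrable_of_hasCompactSupport hc'.mul_left
  refine ⟨hint, ?_⟩
  rw [integral_mul_fderiv_eq_neg_fderiv_mul_of_integrable _ hint
    ((ha.continuous.mul hF.continuous).integrable_of_hasCompactSupport hc.mul_left)
    (fun z _ => ha.contDiffAt.differentiableAt (by norm_num))
    (fun z _ => hF.contDiffAt.differentiableAt (by norm_num))]
  · simp [hae]
  · simp [hae]

theorem integral_along_vX {F : R3 → ℝ} (hF : ContDiff ℝ 1 F) (hc : HasCompactSupport F) :
    Integrable (along vX F) ∧ ∫ z, along vX F z = 0 := by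
  obtain ⟨i1, e1⟩ := integral_mul_fderiv_eq_zero (a := fun _ => 1)
    (e := EuclideanSpace.single 0 1) contDiff_const (by simp) hF hc
  obtain ⟨i2, e2⟩ := integral_mul_fderiv_eq_zero (a := fun z : R3 => 2 * z 1)
    (e := EuclideanSpace.single 2 1) (contDiff_const.mul (contDiff_coord 1))
    (fun z => by rw [((hasFDerivAt_coord 1 z).const_mul 2).fderiv]; simp) hF hc
  have e : along vX F = fun z => (1 : ℝ) * fderiv ℝ F z (EuclideanSpace.single 0 1) +
      2 * z 1 * fderiv ℝ F z (EuclideanSpace.single 2 1) := by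
    funext z
    simp [along, vX]
  rw [e]
  exact ⟨i1.add i2, by rw [integral_add i1 i2, e1, e2, add_zero]⟩

theorem integral_along_vY {F : R3 → ℝ} (hF : ContDiff ℝ 1 F) (hc : HasCompactSupport F) :
    Integrable (along vY F) ∧ ∫ z, along vY F z = 0 := by
  obtain ⟨i1, e1⟩ := integral_mul_fderiv_eq_zero (a := fun _ => 1)
    (e := EuclideanSpace.single 1 1) contDiff_const (by simp) hF hc
  obtain ⟨i2, e2⟩ := integral_mul_fderiv_eq_zero (a := fun z : R3 => 2 * z 0)
    (e := EuclideanSpace.single 2 1) (contDiff_const.mul (contDiff_coord 0))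
    (fun z => by rw [((hasFDerivAt_coord 0 z).const_mul 2).fderiv]; simp) hF hc
  have e : along vY F = fun z => (1 : ℝ) * fderiv ℝ F z (EuclideanSpace.single 1 1) -
      2 * z 0 * fderiv ℝ F z (EuclideanSpace.single 2 1) := by
    funext z
    simp [along, vY]
  rw [e]
  exact ⟨i1.sub i2, by rw [integral_sub i1 i2, e1, e2, sub_zero]⟩

/-! ### The polarization of the Monge–Ampère density -/

/-- The symmetric bilinear form whose quadratic form is `mongeAmpere`. -/
noncomputable def polar (f s : R3 → ℝ) (z : R3) : ℝ :=
  (along vX (along vX f) z * along vY (along vY s) z +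
      along vY (along vY f) z * along vX (along vX s) z) / 2 -
    (along vX (along vY f) z + along vY (along vX f) z) / 2 *
      ((along vX (along vY s) z + along vY (along vX s) z) / 2) +
    12 * (along vT f z * along vT s z)

theorem along_combination {V : R3 → R3} {a p b c q : R3 → ℝ} {z : R3} (k : ℝ)
    (ha : DifferentiableAt ℝ a z) (hp : DifferentiableAt ℝ p z) (hb : DifferentiableAt ℝ b z)
    (hc : DifferentiableAt ℝ c z) (hq : DifferentiableAt ℝ q z) :
    along V (fun z => a z * p z - (b z + k * c z) * q z) z =
      along V a z * p z + a z * along V p z - (along V b z + k * along V c z) * q z -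
        (b z + k * c z) * along V q z := by
  have h := ((ha.hasFDerivAt.mul hp.hasFDerivAt).sub
    ((hb.hasFDerivAt.add (hc.hasFDerivAt.const_mul k)).mul hq.hasFDerivAt)).fderiv
  have h' : fderiv ℝ (fun z => a z * p z - (b z + k * c z) * q z) z = _ := h
  simp only [along]
  rw [h']
  simp
  ring

theorem hasCompactSupport_along {V : R3 → R3} {f : R3 → ℝ} (hc : HasCompactSupport f) :
    HasCompactSupport (along V f) :=
  (hc.fderiv (𝕜 := ℝ)).mono' fun z hz => subset_tsupport _ fun h => hz (by simp [along, h])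

/-- `polar f s` is a horizontal divergence. Only `s` carries third derivatives, so `f` need only be
C². -/
theorem integral_polar_eq_zero_of_contDiff_three {f s : R3 → ℝ} (hf : ContDiff ℝ 2 f)
    (hc : HasCompactSupport f) (hs : ContDiff ℝ 3 s) : ∫ z, polar f s z = 0 := by
  have hX1 : ContDiff ℝ 1 (along vX f) := contDiff_along contDiff_vX hf (by norm_num)
  have hY1 : ContDiff ℝ 1 (along vY f) := contDiff_along contDiff_vY hf (by norm_num)
  have hX : ContDiff ℝ 2 (along vX s) := contDiff_along contDiff_vX hs (by norm_num)
  have hY : ContDiff ℝ 2 (along vY s) := contDiff_along contDiff_vY hs (by norm_num)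
  have hT : ContDiff ℝ 1 (along vT s) := contDiff_along contDiff_vT hs (by norm_num)
  have hXX : ContDiff ℝ 1 (along vX (along vX s)) := contDiff_along contDiff_vX hX (by norm_num)
  have hXY : ContDiff ℝ 1 (along vX (along vY s)) := contDiff_along contDiff_vX hY (by norm_num)
  have hYX : ContDiff ℝ 1 (along vY (along vX s)) := contDiff_along contDiff_vY hX (by norm_num)
  have hYY : ContDiff ℝ 1 (along vY (along vY s)) := contDiff_along contDiff_vY hY (by norm_num)
  have d : ∀ {g : R3 → ℝ}, ContDiff ℝ 1 g → ∀ z, DifferentiableAt ℝ g z :=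
    fun hg z => hg.contDiffAt.differentiableAt (by norm_num)
  have hcX := hasCompactSupport_along (V := vX) hc
  have hcY := hasCompactSupport_along (V := vY) hc
  -- With `H` the mixed entry of the Hessian of `s`, the coefficients `YXs + 4Ts` and `XYs - 4Ts`
  -- here and below equal `H + 6Ts` and `H - 6Ts`. The shifts by 4 cancel the third derivatives of
  -- `s`; paired with the terms `∓2Tf` in `XYf` and `YXf`, the shifts by 6 produce the constant 12.
  obtain ⟨i1, e1⟩ := integral_along_vX (F := fun z => along vY (along vY s) z * along vX f z -
      (along vY (along vX s) z + 4 * along vT s z) * along vY f z)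
    ((hYY.mul hX1).sub ((hYX.add (contDiff_const.mul hT)).mul hY1))
    (hcX.mul_left.sub hcY.mul_left)
  obtain ⟨i2, e2⟩ := integral_along_vY (F := fun z => along vX (along vX s) z * along vY f z -
      (along vX (along vY s) z + (-4) * along vT s z) * along vX f z)
    ((hXX.mul hY1).sub ((hXY.add (contDiff_const.mul hT)).mul hX1))
    (hcY.mul_left.sub hcX.mul_left)
  have key : polar f s = fun z => (along vX (fun z => along vY (along vY s) z * along vX f z -
      (along vY (along vX s) z + 4 * along vT s z) * along vY f z) z +
      along vY (fun z => along vX (along vX s) z * along vY f z -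
      (along vX (along vY s) z + (-4) * along vT s z) * along vX f z) z) * (1 / 2) := by
    funext z
    rw [along_combination 4 (d hYY z) (d hX1 z) (d hYX z) (d hT z) (d hY1 z),
      along_combination (-4) (d hXX z) (d hY1 z) (d hXY z) (d hT z) (d hX1 z),
      commute_X_Y hY.contDiffAt, commute_X_Y hX.contDiffAt,
      commute_T_X (hs.contDiffAt.of_le (by norm_num)),
      commute_T_Y (hs.contDiffAt.of_le (by norm_num)), polar,
      commute_X_Y hf.contDiffAt, commute_X_Y (hs.contDiffAt.of_le (by norm_num))]
    ring
  rw [key, integral_mul_const, integral_add i1 i2, e1, e2]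
  simp

/-! ### Mollification -/

section Mollification

open scoped Convolution

variable {E : Type*} [NormedAddCommGroup E] [NormedSpace ℝ E] [CompleteSpace E]

/-- Convolution with a normalized bump function. -/
noncomputable def mollify (φ : ContDiffBump (0 : R3)) (g : R3 → E) : R3 → E :=
  φ.normed volume ⋆[ContinuousLinearMap.lsmul ℝ ℝ, volume] g

omit [CompleteSpace E] in
theorem fderiv_mollify (φ : ContDiffBump (0 : R3)) {g : R3 → E} (hg : ContDiff ℝ 1 g)
    (hc : HasCompactSupport g) : fderiv ℝ (mollify φ g) = mollify φ (fderiv ℝ g) := by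
  funext z
  have h := (hc.hasFDerivAt_convolution_right (ContinuousLinearMap.lsmul ℝ ℝ)
    (μ := (volume : Measure R3))
    ((φ.continuous_normed (μ := (volume : Measure R3))).locallyIntegrable) hg z).fderiv
  have e : (ContinuousLinearMap.lsmul ℝ ℝ : ℝ →L[ℝ] E →L[ℝ] E).precompR R3 =
      ContinuousLinearMap.lsmul ℝ ℝ := by
    ext
    simp [ContinuousLinearMap.precompR]
  rw [e] at h
  exact h

/-- The mollification at `z` averages values within `2 * C` of `g z`. The constant 3 is not sharp;
what matters is that the bound does not depend on `φ`. -/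
theorem norm_mollify_le (φ : ContDiffBump (0 : R3)) {g : R3 → E} (hg : Continuous g) {C : ℝ}
    (hC : ∀ z, ‖g z‖ ≤ C) (z : R3) : ‖mollify φ g z‖ ≤ 3 * C := by
  have h := φ.dist_normed_convolution_le (μ := (volume : Measure R3)) (x₀ := z) (ε := 2 * C)
    hg.aestronglyMeasurable fun x _ => by
      rw [dist_eq_norm]
      linarith [norm_sub_le (g x) (g z), hC x, hC z]
  rw [dist_eq_norm] at h
  have h2 : ‖mollify φ g z‖ ≤ ‖mollify φ g z - g z‖ + ‖g z‖ := norm_le_norm_sub_add _ _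
  have h3 : ‖mollify φ g z - g z‖ ≤ 2 * C := h
  linarith [hC z]

omit [CompleteSpace E] in
theorem contDiff_mollify (φ : ContDiffBump (0 : R3)) {g : R3 → E} (hg : Continuous g) (n : ℕ) :
    ContDiff ℝ n (mollify φ g) :=
  φ.hasCompactSupport_normed.contDiff_convolution_left (n := n) _ φ.contDiff_normed
    hg.locallyIntegrable

/-- A sequence of bump functions whose supports shrink to the origin. -/
noncomputable def bump (n : ℕ) : ContDiffBump (0 : R3) where
  rIn := 1 / ((n : ℝ) + 1) / 2
  rOut := 1 / ((n : ℝ) + 1)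
  rIn_pos := by positivity
  rIn_lt_rOut := half_lt_self (by positivity)

theorem tendsto_mollify_bump {g : R3 → E} (hg : Continuous g) (z : R3) :
    Tendsto (fun n => mollify (bump n) g z) atTop (𝓝 (g z)) :=
  ContDiffBump.convolution_tendsto_right_of_continuous
    (φ := bump) tendsto_one_div_add_atTop_nhds_zero_nat hg z

end Mollification

theorem fderiv_fderiv_mollify (φ : ContDiffBump (0 : R3)) {s : R3 → ℝ} (hs : ContDiff ℝ 2 s)
    (hc : HasCompactSupport s) :
    fderiv ℝ (fderiv ℝ (mollify φ s)) = mollify φ (fderiv ℝ (fderiv ℝ s)) := by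
  rw [fderiv_mollify φ (hs.of_le (by norm_num)) hc,
    fderiv_mollify φ (hs.fderiv_right (by norm_num)) (hc.fderiv (𝕜 := ℝ))]

theorem along_along_mollify {V W : R3 → R3} {s : R3 → ℝ} (hW : ContDiff ℝ 1 W)
    (hs : ContDiff ℝ 2 s) (hc : HasCompactSupport s) (φ : ContDiffBump (0 : R3)) (z : R3) :
    along V (along W (mollify φ s)) z = mollify φ (fderiv ℝ (fderiv ℝ s)) z (V z) (W z) +
        mollify φ (fderiv ℝ s) z (fderiv ℝ W z (V z)) := by
  have hm : ContDiff ℝ 2 (mollify φ s) := contDiff_mollify φ hs.continuous 2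
  rw [along_along hW hm.contDiffAt, fderiv_fderiv_mollify φ hs hc,
    fderiv_mollify φ (hs.of_le (by norm_num)) hc]

theorem exists_bound_of_eq_zero_off_compact {E : Type*} [NormedAddCommGroup E] {g : R3 → E}
    (hg : Continuous g) {K : Set R3} (hK : IsCompact K) (h0 : ∀ z, z ∉ K → g z = 0) :
    ∃ C, ∀ z, ‖g z‖ ≤ C := by
  obtain ⟨C, hC⟩ := hK.exists_bound_of_continuousOn hg.continuousOn
  refine ⟨max C 0, fun z => ?_⟩
  by_cases hz : z ∈ K
  · exact (hC z hz).trans (le_max_left _ _)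
  · simp [h0 z hz]

/-- Derivatives pass onto `s` under the convolution, so the bound is uniform in the bump function
and supplies the dominating function for the limit. -/
theorem norm_along_along_mollify_le {s : R3 → ℝ} (hs : ContDiff ℝ 2 s)
    (hc : HasCompactSupport s) : ∃ C₁ C₂ : ℝ, ∀ (V W : R3 → R3), ContDiff ℝ 1 W →
      ∀ (φ : ContDiffBump (0 : R3)) (z : R3), ‖along V (along W (mollify φ s)) z‖ ≤
        C₂ * ‖V z‖ * ‖W z‖ + C₁ * ‖fderiv ℝ W z (V z)‖ := by
  have hd1 : ContDiff ℝ 1 (fderiv ℝ s) := hs.fderiv_right (by norm_num)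
  have hcd : HasCompactSupport (fderiv ℝ s) := hc.fderiv (𝕜 := ℝ)
  have h1 : ∃ C, ∀ z, ‖fderiv ℝ s z‖ ≤ C := hcd.exists_bound_of_continuous hd1.continuous
  have h2 : ∃ C, ∀ z, ‖fderiv ℝ (fderiv ℝ s) z‖ ≤ C :=
    exists_bound_of_eq_zero_off_compact (hd1.continuous_fderiv (by norm_num)) hcd fun z hz =>
      fderiv_of_notMem_tsupport (𝕜 := ℝ) hz
  obtain ⟨C1, hC1⟩ := h1
  obtain ⟨C2, hC2⟩ := h2
  refine ⟨3 * C1, 3 * C2, fun V W hW φ z => ?_⟩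
  have b1 : ‖mollify φ (fderiv ℝ s) z‖ ≤ 3 * C1 := norm_mollify_le φ hd1.continuous hC1 z
  have b2 : ‖mollify φ (fderiv ℝ (fderiv ℝ s)) z‖ ≤ 3 * C2 :=
    norm_mollify_le φ (hd1.continuous_fderiv (by norm_num)) hC2 z
  rw [along_along_mollify hW hs hc]
  refine (norm_add_le _ _).trans (add_le_add ?_ ?_)
  · exact (ContinuousLinearMap.le_opNorm₂ _ _ _).trans (mul_le_mul_of_nonneg_right
      (mul_le_mul_of_nonneg_right b2 (norm_nonneg _)) (norm_nonneg _))
  · exact (ContinuousLinearMap.le_opNorm _ _).trans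
      (mul_le_mul_of_nonneg_right b1 (norm_nonneg _))

theorem tendsto_along_along_mollify {V W : R3 → R3} {s : R3 → ℝ} (hW : ContDiff ℝ 1 W)
    (hs : ContDiff ℝ 2 s) (hc : HasCompactSupport s) (z : R3) :
    Tendsto (fun n => along V (along W (mollify (bump n) s)) z) atTop
      (𝓝 (along V (along W s) z)) := by
  have hd1 : ContDiff ℝ 1 (fderiv ℝ s) := hs.fderiv_right (by norm_num)
  have t1 : Tendsto (fun n => mollify (bump n) (fderiv ℝ s) z) atTop (𝓝 (fderiv ℝ s z)) :=
    tendsto_mollify_bump hd1.continuous z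
  have t2 : Tendsto (fun n => mollify (bump n) (fderiv ℝ (fderiv ℝ s)) z) atTop
      (𝓝 (fderiv ℝ (fderiv ℝ s) z)) :=
    tendsto_mollify_bump (hd1.continuous_fderiv (by norm_num)) z
  simp_rw [along_along_mollify hW hs hc]
  rw [along_along hW hs.contDiffAt]
  have a1 : Continuous fun L : R3 →L[ℝ] ℝ => L (fderiv ℝ W z (V z)) :=
    continuous_id.clm_apply continuous_const
  have a2 : Continuous fun L : R3 →L[ℝ] R3 →L[ℝ] ℝ => L (V z) (W z) :=
    (continuous_id.clm_apply continuous_const).clm_apply continuous_const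
  exact ((a2.tendsto _).comp t2).add ((a1.tendsto _).comp t1)

theorem continuous_along_along {V W : R3 → R3} {s : R3 → ℝ} (hV : ContDiff ℝ 1 V)
    (hW : ContDiff ℝ 1 W) (hs : ContDiff ℝ 2 s) : Continuous (along V (along W s)) :=
  (contDiff_along (n := 0) (m := 1) (hV.of_le (by norm_num))
    (contDiff_along (n := 1) hW hs (by norm_num)) (by norm_num)).continuous

theorem tendsto_integral_along_along_mollify {V W : R3 → R3} {a s : R3 → ℝ}
    (hV : ContDiff ℝ 1 V) (hW : ContDiff ℝ 1 W) (ha : Continuous a) (hac : HasCompactSupport a)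
    (hs : ContDiff ℝ 2 s) (hc : HasCompactSupport s) :
    Tendsto (fun n => ∫ z, a z * along V (along W (mollify (bump n) s)) z) atTop
      (𝓝 (∫ z, a z * along V (along W s) z)) := by
  obtain ⟨C1, C2, hC⟩ := norm_along_along_mollify_le hs hc
  have hWV : Continuous fun z => fderiv ℝ W z (V z) :=
    (hW.continuous_fderiv (by norm_num)).clm_apply hV.continuous
  have hbound : Continuous fun z => C2 * ‖V z‖ * ‖W z‖ + C1 * ‖fderiv ℝ W z (V z)‖ :=
    ((continuous_const.mul hV.continuous.norm).mul hW.continuous.norm).add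
      (continuous_const.mul hWV.norm)
  refine tendsto_integral_of_dominated_convergence
    (fun z => ‖a z‖ * (C2 * ‖V z‖ * ‖W z‖ + C1 * ‖fderiv ℝ W z (V z)‖)) (fun n => ?_) ?_
    (fun n => Eventually.of_forall fun z => ?_) (Eventually.of_forall fun z => ?_)
  · exact (ha.mul (continuous_along_along hV hW
      (contDiff_mollify (bump n) hs.continuous 2))).aestronglyMeasurable
  · exact (ha.norm.mul hbound).integrable_of_hasCompactSupport hac.norm.mul_right
  · rw [norm_mul]
    exact mul_le_mul_of_nonneg_left (hC V W hW _ z) (norm_nonneg _)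
  · exact tendsto_const_nhds.mul (tendsto_along_along_mollify hW hs hc z)

theorem tsupport_along_subset (V : R3 → R3) (f : R3 → ℝ) : tsupport (along V f) ⊆ tsupport f :=
  closure_minimal (fun z hz => by
    by_contra h
    exact hz (by simp [along, fderiv_of_notMem_tsupport (𝕜 := ℝ) h])) (isClosed_tsupport f)

/-- The form `polar f` is a linear combination of second order operators whose coefficients are
continuous with compact support when `f` is `C²` with compact support. -/
theorem exists_polar_eq {f : R3 → ℝ} (hf : ContDiff ℝ 2 f) (hc : HasCompactSupport f) :
    ∃ a : Fin 2 → Fin 2 → R3 → ℝ, (∀ i j, Continuous (a i j) ∧ HasCompactSupport (a i j)) ∧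
      ∀ s : R3 → ℝ, ContDiff ℝ 2 s → ∀ z, polar f s z =
        ∑ i, ∑ j, a i j z * along (![vX, vY] i) (along (![vX, vY] j) s) z := by
  have hX : ContDiff ℝ 1 vX := contDiff_vX
  have hY : ContDiff ℝ 1 vY := contDiff_vY
  have cT : Continuous (along vT f) :=
    (contDiff_along (n := 1) contDiff_vT hf (by norm_num)).continuous
  have cXX := continuous_along_along hX hX hf
  have cXY := continuous_along_along hX hY hf
  have cYX := continuous_along_along hY hX hf
  have cYY := continuous_along_along hY hY hf
  have s1 : ∀ (V : R3 → R3) z, z ∉ tsupport f → along V f z = 0 := fun V z hz =>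
    image_eq_zero_of_notMem_tsupport fun h => hz (tsupport_along_subset V f h)
  have s2 : ∀ (V W : R3 → R3) z, z ∉ tsupport f → along V (along W f) z = 0 := fun V W z hz =>
    image_eq_zero_of_notMem_tsupport fun h => hz
      (tsupport_along_subset W f (tsupport_along_subset V _ h))
  refine ⟨![![fun z => along vY (along vY f) z / 2,
      fun z => -(along vX (along vY f) z + along vY (along vX f) z) / 4 - 3 * along vT f z],
    ![fun z => -(along vX (along vY f) z + along vY (along vX f) z) / 4 + 3 * along vT f z,
      fun z => along vX (along vX f) z / 2]], fun i j => ⟨?_, ?_⟩, fun s hs z => ?_⟩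
  · fin_cases i <;> fin_cases j <;> simp <;> fun_prop
  · refine HasCompactSupport.intro hc fun z hz => ?_
    fin_cases i <;> fin_cases j <;> simp [s1 _ z hz, s2 _ _ z hz]
  · have h := commute_X_Y (z := z) hs.contDiffAt
    -- Writing `∂ₜ s` as a commutator makes `polar f` purely second order in `s`; the term `12 Tf
    -- Ts` becomes the two coefficients `∓3 Tf`.
    have h' : along vT s z = (along vY (along vX s) z - along vX (along vY s) z) / 4 := by linarith
    simp [Fin.sum_univ_two, polar, h']
    ring

/-- The identity holds for the smooth mollifications of `s`, and both sides pass to the limit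
because only second derivatives of `s` occur in the integral. -/
theorem integral_polar_eq_zero {f s : R3 → ℝ} (hf : ContDiff ℝ 2 f) (hfc : HasCompactSupport f)
    (hs : ContDiff ℝ 2 s) (hsc : HasCompactSupport s) : ∫ z, polar f s z = 0 := by
  obtain ⟨a, ha, hpolar⟩ := exists_polar_eq hf hfc
  have hV : ∀ i : Fin 2, ContDiff ℝ 1 (![vX, vY] i) := fun i => by
    fin_cases i
    · exact contDiff_vX
    · exact contDiff_vY
  have expand : ∀ g : R3 → ℝ, ContDiff ℝ 2 g → ∫ z, polar f g z =
      ∑ i, ∑ j, ∫ z, a i j z * along (![vX, vY] i) (along (![vX, vY] j) g) z := fun g hg => by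
    have hint : ∀ i j : Fin 2, Integrable
        fun z => a i j z * along (![vX, vY] i) (along (![vX, vY] j) g) z := fun i j =>
      ((ha i j).1.mul (continuous_along_along (hV i) (hV j) hg)).integrable_of_hasCompactSupport
        (ha i j).2.mul_right
    simp_rw [hpolar g hg]
    rw [integral_finsetSum _ fun i _ => integrable_finsetSum _ fun j _ => hint i j]
    exact Finset.sum_congr rfl fun i _ => integral_finsetSum _ fun j _ => hint i j
  have hlim : Tendsto (fun n => ∫ z, polar f (mollify (bump n) s) z) atTop
      (𝓝 (∫ z, polar f s z)) := by
    rw [expand s hs]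
    simp_rw [fun n => expand _ (contDiff_mollify (bump n) hs.continuous 2)]
    exact tendsto_finsetSum _ fun i _ => tendsto_finsetSum _ fun j _ =>
      tendsto_integral_along_along_mollify (hV i) (hV j) (ha i j).1 (ha i j).2 hs hsc
  have hzero : ∀ n, ∫ z, polar f (mollify (bump n) s) z = 0 := fun n =>
    integral_polar_eq_zero_of_contDiff_three hf hfc (contDiff_mollify (bump n) hs.continuous 3)
  simp_rw [hzero] at hlim
  exact tendsto_nhds_unique hlim tendsto_const_nhds

/-! ### Truncation functions -/

/-- A smooth monotone function vanishing for `r ≤ 1 / (n + 1)` and equal to `1` for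
`2 / (n + 1) ≤ r`. -/
noncomputable def ramp (n : ℕ) (r : ℝ) : ℝ := Real.smoothTransition (((n : ℝ) + 1) * r - 1)

theorem contDiff_ramp (n : ℕ) {k : ℕ∞} : ContDiff ℝ k (ramp n) :=
  Real.smoothTransition.contDiff.comp ((contDiff_const.mul contDiff_id).sub contDiff_const)

theorem ramp_nonneg (n : ℕ) (r : ℝ) : 0 ≤ ramp n r := Real.smoothTransition.nonneg _

theorem ramp_le_one (n : ℕ) (r : ℝ) : ramp n r ≤ 1 := Real.smoothTransition.le_one _

theorem ramp_mono (n : ℕ) : Monotone (ramp n) := fun r r' h =>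
  Real.smoothTransition.monotone (by gcongr)

theorem ramp_eq_zero {n : ℕ} {r : ℝ} (h : r ≤ 1 / ((n : ℝ) + 1)) : ramp n r = 0 := by
  apply Real.smoothTransition.zero_of_nonpos
  rw [le_div_iff₀ (by positivity)] at h
  linarith

theorem ramp_eq_one {n : ℕ} {r : ℝ} (h : 2 ≤ ((n : ℝ) + 1) * r) : ramp n r = 1 :=
  Real.smoothTransition.one_of_one_le (by linarith)

theorem deriv_ramp_nonneg (n : ℕ) (r : ℝ) : 0 ≤ deriv (ramp n) r := (ramp_mono n).deriv_nonneg

/-- Such an `r` is a minimum point of the nonnegative function `ramp n`; this covers the endpoint as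
well. -/
theorem deriv_ramp_eq_zero {n : ℕ} {r : ℝ} (h : r ≤ 1 / ((n : ℝ) + 1)) : deriv (ramp n) r = 0 :=
  IsLocalMin.deriv_eq_zero (Eventually.of_forall fun r' => by
    rw [ramp_eq_zero h]
    exact ramp_nonneg n r')

theorem tendsto_ramp {r : ℝ} (hr : 0 < r) : Tendsto (fun n => ramp n r) atTop (𝓝 1) := by
  obtain ⟨N, hN⟩ := exists_nat_ge (2 / r)
  refine tendsto_const_nhds.congr' ?_
  filter_upwards [eventually_ge_atTop N] with n hn
  refine (ramp_eq_one ?_).symm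
  rw [div_le_iff₀ hr] at hN
  have : (N : ℝ) ≤ n := by exact_mod_cast hn
  nlinarith

/-- The primitive of `ramp n` vanishing for `r ≤ 1 / (n + 1)`. -/
noncomputable def rampPrimitive (n : ℕ) (r : ℝ) : ℝ := ∫ t in (1 / ((n : ℝ) + 1))..r, ramp n t

theorem hasDerivAt_rampPrimitive (n : ℕ) (r : ℝ) :
    HasDerivAt (rampPrimitive n) (ramp n r) r :=
  have hc : Continuous (ramp n) := (contDiff_ramp n (k := 0)).continuous
  intervalIntegral.integral_hasDerivAt_right (hc.intervalIntegrable _ _)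
    (hc.stronglyMeasurableAtFilter _ _) hc.continuousAt

theorem contDiff_rampPrimitive (n : ℕ) : ContDiff ℝ 2 (rampPrimitive n) := by
  have e : deriv (rampPrimitive n) = ramp n := funext fun r => (hasDerivAt_rampPrimitive n r).deriv
  rw [show (2 : WithTop ℕ∞) = 1 + 1 by norm_num, contDiff_succ_iff_deriv]
  refine ⟨fun r => (hasDerivAt_rampPrimitive n r).differentiableAt, by simp, ?_⟩
  rw [e]
  exact contDiff_ramp n

theorem rampPrimitive_eq_zero {n : ℕ} {r : ℝ} (h : r ≤ 1 / ((n : ℝ) + 1)) :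
    rampPrimitive n r = 0 := by
  rw [rampPrimitive, intervalIntegral.integral_symm, intervalIntegral.integral_zero_ae, neg_zero]
  refine Eventually.of_forall fun t ht => ramp_eq_zero ?_
  rw [Set.uIoc_of_le h] at ht
  exact ht.2

/-! ### Chain rule and locality -/

theorem along_along_comp {V W : R3 → R3} {g p : ℝ → ℝ} {w : R3 → ℝ} {z : R3}
    (hW : ContDiff ℝ 1 W) (hg : ∀ r, HasDerivAt g (p r) r) (hp : ContDiff ℝ 1 p)
    (hw : ContDiffAt ℝ 2 w z) :
    along V (along W (fun y => g (w y))) z =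
      p (w z) * along V (along W w) z + deriv p (w z) * (along V w z * along W w z) := by
  have h1 : along W (fun y => g (w y)) =ᶠ[𝓝 z] fun y => p (w y) * along W w y := by
    filter_upwards [hw.eventually (by simp)] with y hy
    have hd : HasFDerivAt w (fderiv ℝ w y) y := (hy.differentiableAt (by norm_num)).hasFDerivAt
    have := ((hg (w y)).comp_hasFDerivAt y hd).fderiv
    have h : fderiv ℝ (fun y => g (w y)) y = _ := this
    rw [along, h]
    simp [along]
  rw [(along_congr h1).eq_of_nhds]
  have hw1 : HasFDerivAt w (fderiv ℝ w z) z := (hw.differentiableAt (by norm_num)).hasFDerivAt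
  have hp1 : HasDerivAt p (deriv p (w z)) (w z) :=
    (hp.contDiffAt.differentiableAt (by norm_num)).hasDerivAt
  have hW1 : HasFDerivAt (along W w) (fderiv ℝ (along W w) z) z :=
    ((contDiffAt_along (n := 1) hW hw (by norm_num)).differentiableAt (by norm_num)).hasFDerivAt
  have h2 : fderiv ℝ (fun y => p (w y) * along W w y) z = _ :=
    ((hp1.comp_hasFDerivAt z hw1).mul hW1).fderiv
  rw [along, h2]
  simp [along]
  ring

theorem along_along_congr {V W : R3 → R3} {f g : R3 → ℝ} {z : R3} (h : f =ᶠ[𝓝 z] g) :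
    along V (along W f) z = along V (along W g) z :=
  (along_congr (along_congr h)).eq_of_nhds

theorem along_zero (V : R3 → R3) : along V (fun _ => 0) = fun _ => 0 := by
  funext z
  simp [along]

theorem polar_congr {f f' s s' : R3 → ℝ} {z : R3} (hf : f =ᶠ[𝓝 z] f') (hs : s =ᶠ[𝓝 z] s') :
    polar f s z = polar f' s' z := by
  simp only [polar, along_along_congr hf, along_along_congr hs, (along_congr hf).eq_of_nhds,
    (along_congr hs).eq_of_nhds]

theorem polar_zero_left (s : R3 → ℝ) (z : R3) : polar (fun _ => 0) s z = 0 := by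
  simp [polar, along_zero]

theorem along_comp {V : R3 → R3} {g p : ℝ → ℝ} {w : R3 → ℝ} {z : R3}
    (hg : ∀ r, HasDerivAt g (p r) r) (hw : DifferentiableAt ℝ w z) :
    along V (fun y => g (w y)) z = p (w z) * along V w z := by
  have h : fderiv ℝ (fun y => g (w y)) z = _ :=
    ((hg (w z)).comp_hasFDerivAt z hw.hasFDerivAt).fderiv
  rw [along, h]
  simp [along]

/-- The quadratic form of the cofactor matrix of the horizontal Hessian of `s`, evaluated at the
horizontal gradient of `w`. -/
noncomputable def cofactorForm (w s : R3 → ℝ) (z : R3) : ℝ :=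
  along vY (along vY s) z * along vX w z ^ 2 -
    (along vX (along vY s) z + along vY (along vX s) z) * (along vX w z * along vY w z) +
    along vX (along vX s) z * along vY w z ^ 2

/-- The gradient squares from the chain rule for second derivatives assemble into the cofactor form.
The `∂ₜ` term is first order and contributes only to the factor `p (w z)`. -/
theorem polar_comp {g p : ℝ → ℝ} {w s : R3 → ℝ} {z : R3} (hg : ∀ r, HasDerivAt g (p r) r)
    (hp : ContDiff ℝ 1 p) (hw : ContDiffAt ℝ 2 w z) :
    polar (fun y => g (w y)) s z =
      p (w z) * polar w s z + deriv p (w z) / 2 * cofactorForm w s z := by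
  simp only [polar, cofactorForm, along_along_comp contDiff_vX hg hp hw,
    along_along_comp contDiff_vY hg hp hw, along_comp hg (hw.differentiableAt (by norm_num))]
  ring

/-- In dimension two the cofactor matrix is the Hessian conjugated by a quarter turn, so the Hessian
is tested on the rotated gradient `(Yw, -Xw)`. -/
theorem cofactorForm_nonneg {w s : R3 → ℝ} {z : R3} (h : (hess s z).PosSemidef) :
    0 ≤ cofactorForm w s z := by
  have h2 := h.dotProduct_mulVec_nonneg ![along vY w z, -along vX w z]
  simp [hess, X_eq_along, Y_eq_along, Matrix.mulVec, dotProduct, Fin.sum_univ_two] at h2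
  rw [cofactorForm]
  linarith

/-! ### Extension by zero of truncated functions -/

section Extension

variable {Ω : Set R3} {w h : R3 → ℝ} {ε : ℝ}

/-- The part of the closure where `w ≥ ε` is closed and misses the frontier, where `w = 0`. A point
outside `Ω` therefore has a neighbourhood free of it. -/
theorem indicator_eventuallyEq_zero (hΩ : IsOpen Ω) (hw : ContinuousOn w (closure Ω))
    (hbd : ∀ z ∈ frontier Ω, w z = 0) (hε : 0 < ε) (hh : ∀ z ∈ Ω, w z ≤ ε → h z = 0) {z : R3}
    (hz : z ∉ Ω) : Ω.indicator h =ᶠ[𝓝 z] fun _ => 0 := by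
  have hclosed : IsClosed (closure Ω ∩ w ⁻¹' Set.Ici ε) :=
    hw.preimage_isClosed_of_isClosed isClosed_closure isClosed_Ici
  have hmem : z ∈ (closure Ω ∩ w ⁻¹' Set.Ici ε)ᶜ := fun ⟨h1, h2⟩ => by
    have := hbd z ⟨h1, by rwa [hΩ.interior_eq]⟩
    simp only [Set.mem_preimage, Set.mem_Ici] at h2
    linarith
  filter_upwards [hclosed.isOpen_compl.mem_nhds hmem] with y hy
  by_cases hyΩ : y ∈ Ω
  · rw [Set.indicator_of_mem hyΩ]
    refine hh y hyΩ (le_of_not_ge fun hle => hy ⟨subset_closure hyΩ, hle⟩)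
  · exact Set.indicator_of_notMem hyΩ _

theorem indicator_eventuallyEq (hΩ : IsOpen Ω) {z : R3} (hz : z ∈ Ω) :
    Ω.indicator h =ᶠ[𝓝 z] h := by
  filter_upwards [hΩ.mem_nhds hz] with y hy
  exact Set.indicator_of_mem hy _

theorem contDiff_indicator (hΩ : IsOpen Ω) (hw : ContinuousOn w (closure Ω))
    (hbd : ∀ z ∈ frontier Ω, w z = 0) (hε : 0 < ε) (hh : ∀ z ∈ Ω, w z ≤ ε → h z = 0)
    (hhC : ContDiffOn ℝ 2 h Ω) : ContDiff ℝ 2 (Ω.indicator h) := by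
  refine contDiff_iff_contDiffAt.2 fun z => ?_
  by_cases hz : z ∈ Ω
  · exact (hhC.contDiffAt (hΩ.mem_nhds hz)).congr_of_eventuallyEq (indicator_eventuallyEq hΩ hz)
  · exact contDiffAt_const.congr_of_eventuallyEq
      (indicator_eventuallyEq_zero hΩ hw hbd hε hh hz)

theorem hasCompactSupport_indicator (hΩb : Bornology.IsBounded Ω) :
    HasCompactSupport (Ω.indicator h) :=
  HasCompactSupport.intro hΩb.isCompact_closure fun _ hz =>
    Set.indicator_of_notMem (fun hz' => hz (subset_closure hz')) _

end Extension

/-! ### The truncated inequalities -/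

section Truncated

variable {Ω : Set R3} {w s : R3 → ℝ}

theorem integrable_polar {f : R3 → ℝ} (hf : ContDiff ℝ 2 f) (hfc : HasCompactSupport f)
    (hs : ContDiff ℝ 2 s) : Integrable (polar f s) := by
  obtain ⟨a, ha, hpolar⟩ := exists_polar_eq hf hfc
  have hV : ∀ i : Fin 2, ContDiff ℝ 1 (![vX, vY] i) := fun i => by
    fin_cases i
    · exact contDiff_vX
    · exact contDiff_vY
  rw [funext (hpolar s hs)]
  exact integrable_finsetSum _ fun i _ => integrable_finsetSum _ fun j _ =>
    ((ha i j).1.mul (continuous_along_along (hV i) (hV j) hs)).integrable_of_hasCompactSupport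
      (ha i j).2.mul_right

/-- Both arguments of `polar` are cut off to compactly supported C² functions on the whole space,
whose `polar` integrates to zero and dominates the integrand in `Ω`. -/
theorem setIntegral_ramp_mul_polar_nonpos (hΩ : IsOpen Ω) (hΩb : Bornology.IsBounded Ω)
    (hw : ContinuousOn w (closure Ω)) (hwC : ContDiffOn ℝ 2 w Ω)
    (hbd : ∀ z ∈ frontier Ω, w z = 0) (hs : HConvexOn Ω s) (n : ℕ)
    (hint : IntegrableOn (fun z => ramp n (w z) * polar w s z) Ω) :
    ∫ z in Ω, ramp n (w z) * polar w s z ≤ 0 := by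
  set ψ : R3 → ℝ := Ω.indicator fun z => rampPrimitive n (w z) with hψ
  -- The index `2 * n + 1` makes this cutoff equal to 1 as soon as `w ≥ 1 / (n + 1)`, so `S = s`
  -- wherever `ψ` can be nonzero.
  set S : R3 → ℝ := Ω.indicator fun z => ramp (2 * n + 1) (w z) * s z with hS
  have hψ0 : ∀ z ∈ Ω, w z ≤ 1 / ((n : ℝ) + 1) → rampPrimitive n (w z) = 0 :=
    fun z _ => rampPrimitive_eq_zero
  have hn : (0 : ℝ) < 1 / ((n : ℝ) + 1) := by positivity
  have hψC : ContDiff ℝ 2 ψ := contDiff_indicator hΩ hw hbd hn hψ0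
    ((contDiff_rampPrimitive n).comp_contDiffOn hwC)
  have hSC : ContDiff ℝ 2 S := contDiff_indicator hΩ hw hbd
    (show (0 : ℝ) < 1 / (((2 * n + 1 : ℕ) : ℝ) + 1) by positivity)
    (fun z _ h => by rw [ramp_eq_zero h, zero_mul])
    (((contDiff_ramp (2 * n + 1)).comp_contDiffOn hwC).mul hs.1)
  have hψc : HasCompactSupport ψ := hasCompactSupport_indicator hΩb
  have hSc : HasCompactSupport S := hasCompactSupport_indicator hΩb
  have hle : ∀ z ∈ Ω, ramp n (w z) * polar w s z ≤ polar ψ S z := fun z hz => by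
    have hwz : ContDiffAt ℝ 2 w z := hwC.contDiffAt (hΩ.mem_nhds hz)
    have hcomp : ∀ s', polar (fun y => rampPrimitive n (w y)) s' z = _ := fun s' =>
      polar_comp (s := s') (hasDerivAt_rampPrimitive n) (contDiff_ramp n) hwz
    -- At low values of `w`, `S` may differ from `s`, but the ramp and its derivative both vanish
    -- there. At higher values `S` agrees with `s` near `z` and convexity applies.
    rcases le_or_gt (w z) (1 / ((n : ℝ) + 1)) with h | h
    · rw [polar_congr (indicator_eventuallyEq hΩ hz) (EventuallyEq.refl _ S), hcomp,
        ramp_eq_zero h, deriv_ramp_eq_zero h]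
      simp
    · have hSs : S =ᶠ[𝓝 z] s := by
        filter_upwards [hΩ.mem_nhds hz, hwz.continuousAt.eventually (lt_mem_nhds h)] with y hy hwy
        rw [hS, Set.indicator_of_mem hy, ramp_eq_one, one_mul]
        rw [div_lt_iff₀ (by positivity)] at hwy
        push_cast
        linarith
      rw [polar_congr (indicator_eventuallyEq hΩ hz) hSs, hcomp]
      exact le_add_of_nonneg_right (mul_nonneg (div_nonneg (deriv_ramp_nonneg _ _) (by norm_num))
        (cofactorForm_nonneg (hs.2 z hz)))
  have hzero : ∀ z ∉ Ω, polar ψ S z = 0 := fun z hz => by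
    rw [polar_congr (indicator_eventuallyEq_zero hΩ hw hbd hn hψ0 hz) (EventuallyEq.refl _ S),
      polar_zero_left]
  calc ∫ z in Ω, ramp n (w z) * polar w s z ≤ ∫ z in Ω, polar ψ S z :=
        setIntegral_mono_on hint (integrable_polar hψC hψc hSC).integrableOn hΩ.measurableSet hle
    _ = ∫ z, polar ψ S z := setIntegral_eq_integral_of_forall_compl_eq_zero hzero
    _ = 0 := integral_polar_eq_zero hψC hψc hSC hSc

/-- The sum of the second derivatives along the two horizontal fields. -/
noncomputable def horizontalLaplacian (f : R3 → ℝ) (z : R3) : ℝ :=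
  along vX (along vX f) z + along vY (along vY f) z

/-- The operator has no coefficients from a second function, so its integral vanishes directly for
C² functions of compact support, without mollification. -/
theorem setIntegral_ramp_mul_horizontalLaplacian_nonpos (hΩ : IsOpen Ω)
    (hΩb : Bornology.IsBounded Ω) (hw : ContinuousOn w (closure Ω)) (hwC : ContDiffOn ℝ 2 w Ω)
    (hbd : ∀ z ∈ frontier Ω, w z = 0) (n : ℕ)
    (hint : IntegrableOn (fun z => ramp n (w z) * horizontalLaplacian w z) Ω) :
    ∫ z in Ω, ramp n (w z) * horizontalLaplacian w z ≤ 0 := by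
  set ψ : R3 → ℝ := Ω.indicator fun z => rampPrimitive n (w z) with hψ
  have hψ0 : ∀ z ∈ Ω, w z ≤ 1 / ((n : ℝ) + 1) → rampPrimitive n (w z) = 0 :=
    fun z _ => rampPrimitive_eq_zero
  have hn : (0 : ℝ) < 1 / ((n : ℝ) + 1) := by positivity
  have hψC : ContDiff ℝ 2 ψ := contDiff_indicator hΩ hw hbd hn hψ0
    ((contDiff_rampPrimitive n).comp_contDiffOn hwC)
  have hψc : HasCompactSupport ψ := hasCompactSupport_indicator hΩb
  obtain ⟨i1, e1⟩ := integral_along_vX (F := along vX ψ)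
    (contDiff_along contDiff_vX hψC (by norm_num)) (hasCompactSupport_along hψc)
  obtain ⟨i2, e2⟩ := integral_along_vY (F := along vY ψ)
    (contDiff_along contDiff_vY hψC (by norm_num)) (hasCompactSupport_along hψc)
  have hle : ∀ z ∈ Ω, ramp n (w z) * horizontalLaplacian w z ≤ horizontalLaplacian ψ z :=
    fun z hz => by
    have hwz : ContDiffAt ℝ 2 w z := hwC.contDiffAt (hΩ.mem_nhds hz)
    have hg := hasDerivAt_rampPrimitive n
    have hind := indicator_eventuallyEq (h := fun z => rampPrimitive n (w z)) hΩ hz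
    rw [horizontalLaplacian, horizontalLaplacian, along_along_congr hind, along_along_congr hind,
      along_along_comp contDiff_vX hg (contDiff_ramp n) hwz,
      along_along_comp contDiff_vY hg (contDiff_ramp n) hwz]
    have h1 := mul_nonneg (deriv_ramp_nonneg n (w z)) (mul_self_nonneg (along vX w z))
    have h2 := mul_nonneg (deriv_ramp_nonneg n (w z)) (mul_self_nonneg (along vY w z))
    linarith
  have hzero : ∀ z ∉ Ω, horizontalLaplacian ψ z = 0 := fun z hz => by
    have h0 := indicator_eventuallyEq_zero hΩ hw hbd hn hψ0 hz
    rw [horizontalLaplacian, along_along_congr h0, along_along_congr h0]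
    simp [along_zero]
  calc ∫ z in Ω, ramp n (w z) * horizontalLaplacian w z
      ≤ ∫ z in Ω, horizontalLaplacian ψ z :=
        setIntegral_mono_on hint (i1.add i2).integrableOn hΩ.measurableSet hle
    _ = ∫ z, horizontalLaplacian ψ z := setIntegral_eq_integral_of_forall_compl_eq_zero hzero
    _ = 0 := by
      simp only [horizontalLaplacian]
      rw [integral_add i1 i2, e1, e2, add_zero]

/-- Positivity of `w` in `Ω` makes the weights tend to 1 pointwise, and `‖F‖` dominates. -/
theorem setIntegral_nonpos_of_ramp {F : R3 → ℝ} (hΩ : IsOpen Ω) (hw : ContinuousOn w Ω)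
    (hpos : ∀ z ∈ Ω, 0 < w z) (hF : IntegrableOn F Ω)
    (h : ∀ n, IntegrableOn (fun z => ramp n (w z) * F z) Ω →
      ∫ z in Ω, ramp n (w z) * F z ≤ 0) : ∫ z in Ω, F z ≤ 0 := by
  have hmeas : ∀ n, AEStronglyMeasurable (fun z => ramp n (w z)) (volume.restrict Ω) := fun n =>
    ((contDiff_ramp n (k := 0)).continuous.comp_continuousOn hw).aestronglyMeasurable
      hΩ.measurableSet
  have hle : ∀ n z, ‖ramp n (w z)‖ ≤ 1 := fun n z => by
    rw [Real.norm_eq_abs, abs_of_nonneg (ramp_nonneg _ _)]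
    exact ramp_le_one _ _
  have hint : ∀ n, IntegrableOn (fun z => ramp n (w z) * F z) Ω := fun n =>
    Integrable.bdd_mul hF (hmeas n) (Eventually.of_forall (hle n))
  have hlim : Tendsto (fun n => ∫ z in Ω, ramp n (w z) * F z) atTop (𝓝 (∫ z in Ω, F z)) := by
    refine tendsto_integral_of_dominated_convergence (fun z => ‖F z‖)
      (fun n => (hint n).aestronglyMeasurable) hF.norm
      (fun n => Eventually.of_forall fun z => ?_) ?_
    · rw [norm_mul]
      exact mul_le_of_le_one_left (norm_nonneg _) (hle n z)
    · filter_upwards [ae_restrict_mem hΩ.measurableSet] with z hz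
      simpa using (tendsto_ramp (hpos z hz)).mul_const (F z)
  exact le_of_tendsto' hlim fun n => h n (hint n)

end Truncated

/-! ### Integrability and linearity -/

section Integrability

variable {Ω : Set R3} {f g : R3 → ℝ}

/-- Boundedness and continuity on a set. -/
def BoundedContinuousOn (Ω : Set R3) (f : R3 → ℝ) : Prop :=
  ContinuousOn f Ω ∧ ∃ C, ∀ z ∈ Ω, |f z| ≤ C

namespace BoundedContinuousOn

theorem add (hf : BoundedContinuousOn Ω f) (hg : BoundedContinuousOn Ω g) :
    BoundedContinuousOn Ω fun z => f z + g z := by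
  obtain ⟨hf, C, hC⟩ := hf
  obtain ⟨hg, D, hD⟩ := hg
  exact ⟨hf.add hg, C + D, fun z hz => (abs_add_le _ _).trans (add_le_add (hC z hz) (hD z hz))⟩

theorem mul (hf : BoundedContinuousOn Ω f) (hg : BoundedContinuousOn Ω g) :
    BoundedContinuousOn Ω fun z => f z * g z := by
  obtain ⟨hf, C, hC⟩ := hf
  obtain ⟨hg, D, hD⟩ := hg
  refine ⟨hf.mul hg, C * D, fun z hz => ?_⟩
  rw [abs_mul]
  exact mul_le_mul (hC z hz) (hD z hz) (abs_nonneg _) ((abs_nonneg _).trans (hC z hz))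

theorem const (c : ℝ) : BoundedContinuousOn Ω fun _ => c :=
  ⟨continuousOn_const, |c|, fun _ _ => le_rfl⟩

theorem integrableOn (hf : BoundedContinuousOn Ω f) (hΩ : IsOpen Ω)
    (hΩb : Bornology.IsBounded Ω) : IntegrableOn f Ω := by
  obtain ⟨hf, C, hC⟩ := hf
  exact IntegrableOn.of_bound hΩb.measure_lt_top (hf.aestronglyMeasurable hΩ.measurableSet) C
    ((ae_restrict_mem hΩ.measurableSet).mono fun z hz => hC z hz)

end BoundedContinuousOn

/-- The continuous extension is bounded on the compact closure. This is the source of integrability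
of all four integrands. -/
theorem C2Closure.exists_bound (hf : C2Closure Ω f) (hΩb : Bornology.IsBounded Ω) {k : ℕ}
    (hk : k ≤ 2) : ∃ C, ∀ z ∈ Ω, ‖iteratedFDeriv ℝ k f z‖ ≤ C := by
  obtain ⟨G, hG, hGe⟩ := hf.2.2 k hk
  obtain ⟨C, hC⟩ := hΩb.isCompact_closure.exists_bound_of_continuousOn hG
  exact ⟨C, fun z hz => by rw [← hGe hz]; exact hC z (subset_closure hz)⟩

theorem C2Closure.along (hf : C2Closure Ω f) (hΩ : IsOpen Ω) (hΩb : Bornology.IsBounded Ω)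
    {V : R3 → R3} (hV : ContDiff ℝ 1 V) : BoundedContinuousOn Ω (along V f) := by
  obtain ⟨C, hC⟩ := hf.exists_bound hΩb (k := 1) (by norm_num)
  obtain ⟨D, hD⟩ := hΩb.isCompact_closure.exists_bound_of_continuousOn hV.continuous.continuousOn
  refine ⟨fun z hz => (contDiffAt_along (n := 1) hV (hf.2.1.contDiffAt (hΩ.mem_nhds hz))
    (by norm_num)).continuousAt.continuousWithinAt, C * D, fun z hz => ?_⟩
  have h1 := hC z hz
  rw [norm_iteratedFDeriv_one] at h1
  exact (ContinuousLinearMap.le_opNorm _ _).trans (mul_le_mul h1 (hD z (subset_closure hz))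
    (norm_nonneg _) ((norm_nonneg _).trans h1))

theorem C2Closure.along_along (hf : C2Closure Ω f) (hΩ : IsOpen Ω)
    (hΩb : Bornology.IsBounded Ω) {V W : R3 → R3} (hV : ContDiff ℝ 1 V) (hW : ContDiff ℝ 1 W) :
    BoundedContinuousOn Ω (Heisenberg.along V (Heisenberg.along W f)) := by
  obtain ⟨C, hC⟩ := hf.exists_bound hΩb (k := 2) le_rfl
  obtain ⟨C', hC'⟩ := hf.exists_bound hΩb (k := 1) (by norm_num)
  have hWV : Continuous fun z => fderiv ℝ W z (V z) :=
    (hW.continuous_fderiv (by norm_num)).clm_apply hV.continuous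
  obtain ⟨D, hD⟩ := hΩb.isCompact_closure.exists_bound_of_continuousOn hV.continuous.continuousOn
  obtain ⟨D', hD'⟩ := hΩb.isCompact_closure.exists_bound_of_continuousOn hW.continuous.continuousOn
  obtain ⟨D'', hD''⟩ := hΩb.isCompact_closure.exists_bound_of_continuousOn hWV.continuousOn
  have hfz : ∀ z ∈ Ω, ContDiffAt ℝ 2 f z := fun z hz => hf.2.1.contDiffAt (hΩ.mem_nhds hz)
  refine ⟨fun z hz => (contDiffAt_along (n := 0) (m := 1) (hV.of_le (by norm_num))
    (contDiffAt_along hW (hfz z hz) (by norm_num)) (by norm_num)).continuousAt.continuousWithinAt,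
    C * D * D' + C' * D'', fun z hz => ?_⟩
  have h2 := hC z hz
  have h1 := hC' z hz
  rw [norm_iteratedFDeriv_one] at h1
  rw [← norm_iteratedFDeriv_fderiv, norm_iteratedFDeriv_one] at h2
  have hzc := subset_closure hz
  have hC0 := (norm_nonneg _).trans h2
  have hC'0 := (norm_nonneg _).trans h1
  have hD0 := (norm_nonneg _).trans (hD z hzc)
  rw [Heisenberg.along_along hW (hfz z hz)]
  refine (abs_add_le _ _).trans (add_le_add ?_ ?_)
  · exact (ContinuousLinearMap.le_opNorm₂ _ _ _).trans (mul_le_mul (mul_le_mul h2 (hD z hzc)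
      (norm_nonneg _) hC0) (hD' z hzc) (norm_nonneg _) (mul_nonneg hC0 hD0))
  · exact (ContinuousLinearMap.le_opNorm _ _).trans (mul_le_mul h1 (hD'' z hzc)
      (norm_nonneg _) hC'0)

/-! ### The two densities: integrability and behaviour under differences. -/

theorem mongeAmpere_eq_polar (u : R3 → ℝ) : mongeAmpere u = polar u u := by
  funext z
  simp only [mongeAmpere, hess, Matrix.det_fin_two_of, X_eq_along, Y_eq_along, T_eq_along, polar]
  ring

theorem trace_hess_eq (u : R3 → ℝ) : (fun z => (hess u z).trace) = horizontalLaplacian u := by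
  funext z
  simp only [hess, Matrix.trace_fin_two_of, X_eq_along, Y_eq_along, horizontalLaplacian]

theorem C2Closure.integrableOn_mongeAmpere (hf : C2Closure Ω f) (hΩ : IsOpen Ω)
    (hΩb : Bornology.IsBounded Ω) : IntegrableOn (mongeAmpere f) Ω := by
  have hXX := hf.along_along hΩ hΩb contDiff_vX contDiff_vX
  have hXY := hf.along_along hΩ hΩb contDiff_vX contDiff_vY
  have hYX := hf.along_along hΩ hΩb contDiff_vY contDiff_vX
  have hYY := hf.along_along hΩ hΩb contDiff_vY contDiff_vY
  have hT := hf.along hΩ hΩb contDiff_vT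
  have h := (((hXX.mul hYY).add ((BoundedContinuousOn.const (-1 / 4)).mul
    ((hXY.add hYX).mul (hXY.add hYX)))).add ((BoundedContinuousOn.const 12).mul
      (hT.mul hT))).integrableOn hΩ hΩb
  rw [mongeAmpere_eq_polar]
  refine h.congr_fun (fun z _ => ?_) hΩ.measurableSet
  simp only [polar]
  ring

theorem C2Closure.integrableOn_horizontalLaplacian (hf : C2Closure Ω f) (hΩ : IsOpen Ω)
    (hΩb : Bornology.IsBounded Ω) : IntegrableOn (horizontalLaplacian f) Ω :=
  ((hf.along_along hΩ hΩb contDiff_vX contDiff_vX).add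
    (hf.along_along hΩ hΩb contDiff_vY contDiff_vY)).integrableOn hΩ hΩb

theorem along_add {V : R3 → R3} {z : R3} (hf : DifferentiableAt ℝ f z)
    (hg : DifferentiableAt ℝ g z) :
    Heisenberg.along V (fun y => f y + g y) z = along V f z + along V g z := by
  simp [along, fderiv_fun_add hf hg]

theorem along_sub {V : R3 → R3} {z : R3} (hf : DifferentiableAt ℝ f z)
    (hg : DifferentiableAt ℝ g z) :
    along V (fun y => f y - g y) z = along V f z - along V g z := by
  simp [along, fderiv_fun_sub hf hg]

theorem along_along_add {V W : R3 → R3} (hW : ContDiff ℝ 1 W) {z : R3} (hf : ContDiffAt ℝ 2 f z)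
    (hg : ContDiffAt ℝ 2 g z) :
    along V (along W fun y => f y + g y) z = along V (along W f) z + along V (along W g) z := by
  have h : along W (fun y => f y + g y) =ᶠ[𝓝 z] fun y => along W f y + along W g y := by
    filter_upwards [hf.eventually (by simp), hg.eventually (by simp)] with y hfy hgy
    exact along_add (hfy.differentiableAt (by norm_num)) (hgy.differentiableAt (by norm_num))
  rw [(along_congr h).eq_of_nhds]
  exact along_add
    ((contDiffAt_along (n := 1) hW hf (by norm_num)).differentiableAt (by norm_num))
    ((contDiffAt_along (n := 1) hW hg (by norm_num)).differentiableAt (by norm_num))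

theorem along_along_sub {V W : R3 → R3} (hW : ContDiff ℝ 1 W) {z : R3} (hf : ContDiffAt ℝ 2 f z)
    (hg : ContDiffAt ℝ 2 g z) :
    along V (along W fun y => f y - g y) z = along V (along W f) z - along V (along W g) z := by
  have h : along W (fun y => f y - g y) =ᶠ[𝓝 z] fun y => along W f y - along W g y := by
    filter_upwards [hf.eventually (by simp), hg.eventually (by simp)] with y hfy hgy
    exact along_sub (hfy.differentiableAt (by norm_num)) (hgy.differentiableAt (by norm_num))
  rw [(along_congr h).eq_of_nhds]
  exact along_sub
    ((contDiffAt_along (n := 1) hW hf (by norm_num)).differentiableAt (by norm_num))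
    ((contDiffAt_along (n := 1) hW hg (by norm_num)).differentiableAt (by norm_num))

/-- Difference of squares for a symmetric bilinear form. -/
theorem polar_sub_add {z : R3} (hf : ContDiffAt ℝ 2 f z) (hg : ContDiffAt ℝ 2 g z) :
    polar (fun y => f y - g y) (fun y => f y + g y) z = polar f f z - polar g g z := by
  have hf1 := hf.differentiableAt (by norm_num)
  have hg1 := hg.differentiableAt (by norm_num)
  simp only [polar, along_along_add contDiff_vX hf hg, along_along_add contDiff_vY hf hg,
    along_along_sub contDiff_vX hf hg, along_along_sub contDiff_vY hf hg,
    along_add hf1 hg1, along_sub hf1 hg1]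
  ring

theorem horizontalLaplacian_sub {z : R3} (hf : ContDiffAt ℝ 2 f z) (hg : ContDiffAt ℝ 2 g z) :
    horizontalLaplacian (fun y => f y - g y) z =
      horizontalLaplacian f z - horizontalLaplacian g z := by
  simp only [horizontalLaplacian, along_along_sub contDiff_vX hf hg,
    along_along_sub contDiff_vY hf hg]
  ring

end Integrability

end Heisenberg

/-! ### The comparison theorem. -/

theorem theorem3p1 (Ω : Set Heisenberg.R3) (hΩ : IsOpen Ω) (hΩb : Bornology.IsBounded Ω)
    (u v : Heisenberg.R3 → ℝ)
    (hu : Heisenberg.C2Closure Ω u) (hv : Heisenberg.C2Closure Ω v)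
    (hconv : Heisenberg.HConvexOn Ω (fun z => u z + v z))
    (hbd : ∀ z ∈ frontier Ω, v z = u z)
    (hlt : ∀ z ∈ Ω, v z < u z) :
    (IntegrableOn (Heisenberg.mongeAmpere u) Ω volume ∧
      IntegrableOn (Heisenberg.mongeAmpere v) Ω volume ∧
      ∫ z in Ω, Heisenberg.mongeAmpere u z ≤ ∫ z in Ω, Heisenberg.mongeAmpere v z) ∧
    (IntegrableOn (fun z => (Heisenberg.hess u z).trace) Ω volume ∧
      IntegrableOn (fun z => (Heisenberg.hess v z).trace) Ω volume ∧
      ∫ z in Ω, (Heisenberg.hess u z).trace ≤ ∫ z in Ω, (Heisenberg.hess v z).trace) := by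
  have hopen : ∀ z ∈ Ω, Ω ∈ nhds z := fun z hz => hΩ.mem_nhds hz
  have hwc : ContinuousOn (fun z => u z - v z) (closure Ω) := hu.1.sub hv.1
  have hwC : ContDiffOn ℝ 2 (fun z => u z - v z) Ω := hu.2.1.sub hv.2.1
  have hw0 : ∀ z ∈ frontier Ω, u z - v z = 0 := fun z hz => by rw [hbd z hz, sub_self]
  have hpos : ∀ z ∈ Ω, 0 < u z - v z := fun z hz => sub_pos.2 (hlt z hz)
  have hMu := hu.integrableOn_mongeAmpere hΩ hΩb
  have hMv := hv.integrableOn_mongeAmpere hΩ hΩb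
  have hLu := hu.integrableOn_horizontalLaplacian hΩ hΩb
  have hLv := hv.integrableOn_horizontalLaplacian hΩ hΩb
  have eM : Set.EqOn (fun z => Heisenberg.mongeAmpere u z - Heisenberg.mongeAmpere v z)
      (Heisenberg.polar (fun z => u z - v z) fun z => u z + v z) Ω := fun z hz => by
    simp only [Heisenberg.mongeAmpere_eq_polar]
    exact (Heisenberg.polar_sub_add (hu.2.1.contDiffAt (hopen z hz))
      (hv.2.1.contDiffAt (hopen z hz))).symm
  have eL : Set.EqOn
      (fun z => Heisenberg.horizontalLaplacian u z - Heisenberg.horizontalLaplacian v z)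
      (Heisenberg.horizontalLaplacian fun z => u z - v z) Ω := fun z hz =>
    (Heisenberg.horizontalLaplacian_sub (hu.2.1.contDiffAt (hopen z hz))
      (hv.2.1.contDiffAt (hopen z hz))).symm
  have iM := (hMu.sub hMv).congr_fun eM hΩ.measurableSet
  have iL := (hLu.sub hLv).congr_fun eL hΩ.measurableSet
  have hM := Heisenberg.setIntegral_nonpos_of_ramp hΩ (hwc.mono subset_closure) hpos iM
    fun n => Heisenberg.setIntegral_ramp_mul_polar_nonpos hΩ hΩb hwc hwC hw0 hconv n
  have hL := Heisenberg.setIntegral_nonpos_of_ramp hΩ (hwc.mono subset_closure) hpos iL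
    fun n => Heisenberg.setIntegral_ramp_mul_horizontalLaplacian_nonpos hΩ hΩb hwc hwC hw0 n
  rw [← setIntegral_congr_fun hΩ.measurableSet eM, integral_sub hMu hMv] at hM
  rw [← setIntegral_congr_fun hΩ.measurableSet eL, integral_sub hLu hLv] at hL
  rw [Heisenberg.trace_hess_eq, Heisenberg.trace_hess_eq]
  exact ⟨⟨hMu, hMv, by linarith⟩, hLu, hLv, by linarith⟩
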